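/- Let $k>1$ and $T\ge 1$ be integers, and let $g_i(t)\in[0,1]$ ($i\in\{1,\dots,k\}$, $t\in\{1,\dots,T\}$) be rewards that are fixed in advance. Let $\mu\in[1,k]$ and $\delta\in(0,1)$, and put $$\eta=\frac1{\sqrt{\mu T}},\qquad \beta=2\eta\sqrt{6\log(3k/\delta)},\qquad \gamma=\eta^2(1+\beta)^2k^2 .$$ The decoupled multi-armed bandit algorithm starts with weights $w_j(1)=1$ for all $j$. In round $t=1,\dots,T$ it puts $$p_j(t)=(1-\gamma)\frac{w_j(t)}{\sum_{l}w_l(t)}+\frac{\gamma}{k},\qquad q_j(t)=\frac{\sqrt{p_j(t)}}{\sum_{l}\sqrt{p_l(t)}},$$ and, conditionally on the past, chooses an action $i_t$ with distribution $p(t)$ and, independently, queries the reward $g_{j_t}(t)$ of an arm $j_t$ with distribution $q(t)$. It then puts, for every $j$, $$\tilde g_j(t)=\frac1{q_j(t)}\left(g_j(t)\mathbf 1_{j_t=j}+\beta\right),\qquad w_j(t+1)=w_j(t)\exp(\eta\,\tilde g_j(t)).$$ For a vector $p$ with nonnegative entries write $\|p\|_{1/2}=\left(\sum_{j}\sqrt{p_j}\right)^2$,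 and for $v\in[1,k]$ let $$P(v,\delta,\mu)=\Pr\left(\frac1T\sum_{t=1}^T\|p(t)\|_{1/2}>v\right).$$ **Theorem.** There is a universal constant $C>0$ such that the following holds for all $k,T,g,\mu,\delta$ as above with $(1+\beta)^2\le 2$, all $v\in[1,k]$, and every run of the algorithm (it can be run whenever the vectors $p(t)$ are probability vectors, in particular if $\gamma\le1$): with probability at least $1-\delta-P(v,\delta,\mu)$, $$\max_{i}\sum_{t=1}^Tg_i(t)-\sum_{t=1}^Tg_{i_t}(t)\le C\log\left(\frac{3k}{\delta}\right)\left(\sqrt{\left(\frac{v^2}{\mu}+\mu+v\right)T}+\frac{k^2}{\mu}+\frac{k^2}{T^{3/2}}\right).$$ -/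

import Mathlib

open MeasureTheory

namespace DecoupledMAB

noncomputable section

/-- The step size `η = 1 / √(μ T)`. -/
def eta (T : ℕ) (μ : ℝ) : ℝ := 1 / √(μ * T)

/-- The bias parameter `β = 2 η √(6 log (3k/δ))`. -/
def beta (k T : ℕ) (μ δ : ℝ) : ℝ := 2 * eta T μ * √(6 * Real.log (3 * k / δ))

/-- The exploration parameter `γ = η² (1 + β)² k²`. -/
def gamma (k T : ℕ) (μ δ : ℝ) : ℝ := eta T μ ^ 2 * (1 + beta k T μ δ) ^ 2 * (k : ℝ) ^ 2

/-- The `ℓ_{1/2}`-"norm" `(∑ⱼ √pⱼ)²` of a vector. -/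
def halfNorm {k : ℕ} (p : Fin k → ℝ) : ℝ := (∑ j, √(p j)) ^ 2

/-- The distribution over actions obtained from the weights `w`:
`pⱼ = (1 - γ) wⱼ / ∑ₗ wₗ + γ / k`. -/
def actionDist (k T : ℕ) (μ δ : ℝ) (w : Fin k → ℝ) (j : Fin k) : ℝ :=
  (1 - gamma k T μ δ) * (w j / ∑ l, w l) + gamma k T μ δ / k

/-- The query distribution `qⱼ = √pⱼ / ∑ₗ √pₗ`. -/
def queryDist {k : ℕ} (p : Fin k → ℝ) (j : Fin k) : ℝ := √(p j) / ∑ l, √(p l)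

/-- The reward estimates `(1 / qⱼ) (gⱼ 𝟙[j' = j] + b)`, where `g` is the reward vector of the round,
`q` the query distribution, `j'` the queried action and `b` the bias parameter. -/
def rewardEstimate {k : ℕ} (b : ℝ) (q g : Fin k → ℝ) (j' j : Fin k) : ℝ :=
  1 / q j * ((if j' = j then g j else 0) + b)

/-- The weights `wⱼ(t)` of the algorithm when the rewards are `g` and the queried actions are `y`.
The rounds are numbered `0, 1, …, T - 1`; the weights at round `t` depend only on the rewards and
queries of the rounds before `t`. -/
def weight (k T : ℕ) (μ δ : ℝ) (g : ℕ → Fin k → ℝ) (y : ℕ → Fin k) : ℕ → Fin k → ℝ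
  | 0 => fun _ => 1
  | t + 1 => fun j =>
      weight k T μ δ g y t j *
        Real.exp (eta T μ * rewardEstimate (beta k T μ δ)
          (queryDist (actionDist k T μ δ (weight k T μ δ g y t))) (g t) (y t) j)

/-- The vector `p(t)` when the rewards are `g` and the queried actions are `y`. -/
def pVec (k T : ℕ) (μ δ : ℝ) (g : ℕ → Fin k → ℝ) (y : ℕ → Fin k) (t : ℕ) : Fin k → ℝ :=
  actionDist k T μ δ (weight k T μ δ g y t)

/-- The vector `q(t)` when the rewards are `g` and the queried actions are `y`. -/
def qVec (k T : ℕ) (μ δ : ℝ) (g : ℕ → Fin k → ℝ) (y : ℕ → Fin k) (t : ℕ) : Fin k → ℝ :=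
  queryDist (pVec k T μ δ g y t)

/-- On the probability space `(Ω, P)`, the random actions `I t` and queries `J t`, `t < T`, are those
of a run of the algorithm with parameters `μ, δ` on the fixed reward sequence `g`: conditionally on
the past choices, the action is drawn from `p(t)` and, independently of it, the query from `q(t)`. -/
structure IsRun {Ω : Type*} [MeasurableSpace Ω] (P : Measure Ω) (k T : ℕ) (μ δ : ℝ)
    (g : ℕ → Fin k → ℝ) (I J : ℕ → Ω → Fin k) : Prop where
  measurable_action : ∀ t < T, Measurable (I t)
  measurable_query : ∀ t < T, Measurable (J t)
  law : ∀ t < T, ∀ x y : ℕ → Fin k, ∀ i j : Fin k,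
    P.real {ω | (∀ s < t, I s ω = x s ∧ J s ω = y s) ∧ I t ω = i ∧ J t ω = j} =
      P.real {ω | ∀ s < t, I s ω = x s ∧ J s ω = y s} *
        (pVec k T μ δ g y t i * qVec k T μ δ g y t j)

/-- `P(v, δ, μ)`: the probability that the average over the rounds of the `ℓ_{1/2}`-"norm" of `p(t)`
exceeds `v`, for the run with queried actions `J`. -/
def excessProb {Ω : Type*} [MeasurableSpace Ω] (P : Measure Ω) (k T : ℕ) (μ δ : ℝ)
    (g : ℕ → Fin k → ℝ) (J : ℕ → Ω → Fin k) (v : ℝ) : ℝ :=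
  P.real {ω | v < 1 / (T : ℝ) *
    ∑ t ∈ Finset.range T, halfNorm (pVec k T μ δ g (fun s => J s ω) t)}

/-- The regret `maxᵢ ∑ₜ gᵢ(t) - ∑ₜ g_{x t}(t)` of the actions `x` over `T` rounds. -/
def regret {k : ℕ} (T : ℕ) (g : ℕ → Fin k → ℝ) (x : ℕ → Fin k) : ℝ :=
  (⨆ i, ∑ t ∈ Finset.range T, g t i) - ∑ t ∈ Finset.range T, g t (x t)

end

end DecoupledMAB

/-! The argument is exponential weights plus martingale concentration. Comparing log-weights with
the log of their sum (`log_sum_weight_le`, `sum_rewardEstimate_le`) bounds the estimated reward of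
every arm, up to the factor `1 - γ`, by `log k / η`, plus the importance-weighted reward `∑ (p/q) g`
at the queried arms, plus a multiple of `∑ ‖p(t)‖_{1/2}`. The choice `q ∝ √p` enters here: it makes
`∑ p/q` equal to `‖p‖_{1/2}` and `p/q²` constant over the arms, so this norm governs both the bias
and the second moment of the estimates.

Two random comparisons remain. The bias `β` makes each estimated total an upper confidence bound:
the total reward of an arm exceeds its estimate by at most `log(3k/δ)/β`
(`sum_exp_sub_rewardEstimate_le`). The importance-weighted reward exceeds the collected reward by an
amount with variance of order `‖p(t)‖_{1/2}` (`sum_exp_weighted_sub_le`). Both are Bernstein moment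
bounds multiplied along the history by `measure_lt_sum_le_exp_neg`.

On the event where these `k + 1` comparisons hold and the average norm is at most `v`, inserting the
parameters gives the regret bound (`parameter_bound`). A union bound finishes the case `γ ≤ 1`. If
`γ > 1`, the bound already exceeds `T` and holds surely. -/

namespace DecoupledMAB

/-! ### Exponential tail bounds for adapted finite-valued processes -/

section Tail

/-- Extension of a finite history by an arbitrary value. -/
def extendHistory {α : Type*} [Inhabited α] {t : ℕ} (h : Fin t → α) (s : ℕ) : α :=
  if hs : s < t then h ⟨s, hs⟩ else default

lemma extendHistory_snoc_of_lt {α : Type*} [Inhabited α] {t : ℕ} (h : Fin t → α) (a : α) {s : ℕ}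
    (hs : s < t) :
    extendHistory (Fin.snoc (α := fun _ => α) h a) s = extendHistory h s := by
  have h1 : s < t + 1 := by omega
  simp [extendHistory, hs, h1, Fin.snoc]

lemma extendHistory_snoc_self {α : Type*} [Inhabited α] {t : ℕ} (h : Fin t → α) (a : α) :
    extendHistory (Fin.snoc (α := fun _ => α) h a) t = a := by
  simp [extendHistory, Fin.snoc]

variable {Ω α : Type*} [MeasurableSpace Ω] [Fintype α] [Inhabited α]

/-- Supermartingale property of the exponentiated sum, written over finite histories: removing the
last coordinate leaves a factor that `hsum` bounds by one. The padding in `extendHistory` is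
harmless because `X t` reads only times before `t`. -/
lemma sum_history_exp_le (P : Measure Ω) [IsProbabilityMeasure P] (T : ℕ) (Z : ℕ → Ω → α)
    (π X : ℕ → (ℕ → α) → α → ℝ)
    (hlaw : ∀ t < T, ∀ (z : ℕ → α) (a : α),
      P.real {ω | (∀ s < t, Z s ω = z s) ∧ Z t ω = a} =
        P.real {ω | ∀ s < t, Z s ω = z s} * π t z a)
    (hX : ∀ t (z z' : ℕ → α), (∀ s < t, z s = z' s) → X t z = X t z')
    (hsum : ∀ t < T, ∀ z, ∑ a, π t z a * Real.exp (X t z a) ≤ 1) (t : ℕ) (ht : t ≤ T) :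
    ∑ h : Fin t → α, P.real {ω | ∀ s < t, Z s ω = extendHistory h s} *
      Real.exp (∑ s ∈ Finset.range t, X s (extendHistory h) (extendHistory h s)) ≤ 1 := by
  induction t with
  | zero => simp
  | succ t ih =>
    refine le_trans ?_ (ih (by omega))
    rw [← (Fin.snocEquiv (fun _ : Fin (t + 1) => α)).sum_comp, Fintype.sum_prod_type,
      Finset.sum_comm]
    refine Finset.sum_le_sum fun h _ => ?_
    have key : ∀ a : α,
        P.real {ω | ∀ s < t + 1, Z s ω =
            extendHistory (Fin.snoc (α := fun _ => α) h a) s} *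
          Real.exp (∑ s ∈ Finset.range (t + 1),
            X s (extendHistory (Fin.snoc (α := fun _ => α) h a))
              (extendHistory (Fin.snoc (α := fun _ => α) h a) s)) =
        P.real {ω | ∀ s < t, Z s ω = extendHistory h s} *
          Real.exp (∑ s ∈ Finset.range t, X s (extendHistory h) (extendHistory h s)) *
          (π t (extendHistory h) a * Real.exp (X t (extendHistory h) a)) := by
      intro a
      have hset : {ω | ∀ s < t + 1, Z s ω = extendHistory (Fin.snoc (α := fun _ => α) h a) s} =
          {ω | (∀ s < t, Z s ω = extendHistory h s) ∧ Z t ω = a} := by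
        ext ω
        simp only [Set.mem_ofPred_eq, Nat.forall_lt_succ_right, extendHistory_snoc_self]
        refine and_congr_left fun _ => forall₂_congr fun s hs => ?_
        rw [extendHistory_snoc_of_lt h a hs]
      have hXeq : ∀ s ≤ t, X s (extendHistory (Fin.snoc (α := fun _ => α) h a)) =
          X s (extendHistory h) := fun s hs =>
        hX s _ _ fun r hr => extendHistory_snoc_of_lt h a (by omega)
      have hS : ∑ s ∈ Finset.range t, X s (extendHistory (Fin.snoc (α := fun _ => α) h a))
              (extendHistory (Fin.snoc (α := fun _ => α) h a) s) =
          ∑ s ∈ Finset.range t, X s (extendHistory h) (extendHistory h s) := by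
        refine Finset.sum_congr rfl fun s hs => ?_
        have hs' := Finset.mem_range.1 hs
        rw [hXeq s hs'.le, extendHistory_snoc_of_lt h a hs']
      rw [hset, hlaw t (by omega), Finset.sum_range_succ, hS, hXeq t le_rfl,
        extendHistory_snoc_self, Real.exp_add]
      ring
    have : ∀ a : α, (Fin.snocEquiv (fun _ : Fin (t + 1) => α)) (a, h) =
        Fin.snoc (α := fun _ => α) h a := fun a => rfl
    simp only [this, key]
    rw [← Finset.mul_sum]
    exact mul_le_of_le_one_right (by positivity) (hsum t (by omega) _)

/-- If the conditional exponential moments of the increments `X t` are at most one, their sum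
exceeds `a` with probability at most `exp (-a)`. -/
lemma measure_lt_sum_le_exp_neg (P : Measure Ω) [IsProbabilityMeasure P] (T : ℕ) (Z : ℕ → Ω → α)
    (π X : ℕ → (ℕ → α) → α → ℝ)
    (hlaw : ∀ t < T, ∀ (z : ℕ → α) (a : α),
      P.real {ω | (∀ s < t, Z s ω = z s) ∧ Z t ω = a} =
        P.real {ω | ∀ s < t, Z s ω = z s} * π t z a)
    (hX : ∀ t (z z' : ℕ → α), (∀ s < t, z s = z' s) → X t z = X t z')
    (hsum : ∀ t < T, ∀ z, ∑ a, π t z a * Real.exp (X t z a) ≤ 1) (a : ℝ) :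
    P.real {ω | a < ∑ t ∈ Finset.range T, X t (fun s => Z s ω) (Z t ω)} ≤ Real.exp (-a) := by
  classical
  set S : (Fin T → α) → ℝ :=
    fun h => ∑ s ∈ Finset.range T, X s (extendHistory h) (extendHistory h s) with hS
  set A : (Fin T → α) → Set Ω := fun h => {ω | ∀ s < T, Z s ω = extendHistory h s} with hA
  -- The event lies in a finite union of history cylinders, so monotonicity and subadditivity
  -- suffice and its measurability plays no role.
  have hsub : {ω | a < ∑ t ∈ Finset.range T, X t (fun s => Z s ω) (Z t ω)} ⊆
      ⋃ h ∈ Finset.univ.filter (fun h => a < S h), A h := by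
    intro ω hω
    have hext : ∀ s < T, extendHistory (fun s : Fin T => Z s ω) s = Z s ω := fun s hs => by
      simp [extendHistory, hs]
    have hSω : S (fun s : Fin T => Z s ω) =
        ∑ t ∈ Finset.range T, X t (fun s => Z s ω) (Z t ω) := by
      refine Finset.sum_congr rfl fun t ht => ?_
      have ht' := Finset.mem_range.1 ht
      rw [hext t ht', hX t _ (fun s => Z s ω) fun s hs => hext s (hs.trans ht')]
    simp only [Set.mem_iUnion, Finset.mem_filter, Finset.mem_univ, true_and, exists_prop]
    exact ⟨fun s : Fin T => Z s ω, by rw [hSω]; exact hω, fun s hs => (hext s hs).symm⟩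
  calc _ ≤ P.real (⋃ h ∈ Finset.univ.filter (fun h => a < S h), A h) := measureReal_mono hsub (measure_ne_top _ _)
    _ ≤ ∑ h ∈ Finset.univ.filter (fun h => a < S h), P.real (A h) :=
        measureReal_biUnion_finset_le _ _
    _ ≤ ∑ h ∈ Finset.univ.filter (fun h => a < S h),
          Real.exp (-a) * (P.real (A h) * Real.exp (S h)) := by
        refine Finset.sum_le_sum fun h hh => ?_
        -- Markov's inequality, one history at a time.
        have h1 : 1 ≤ Real.exp (-a) * Real.exp (S h) := by
          rw [← Real.exp_add]
          exact Real.one_le_exp (by linarith [(Finset.mem_filter.1 hh).2])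
        have h2 : 0 ≤ P.real (A h) := measureReal_nonneg
        nlinarith
    _ ≤ ∑ h, Real.exp (-a) * (P.real (A h) * Real.exp (S h)) :=
        Finset.sum_le_sum_of_subset_of_nonneg (Finset.filter_subset _ _)
          fun _ _ _ => mul_nonneg (Real.exp_nonneg _)
            (mul_nonneg measureReal_nonneg (Real.exp_nonneg _))
    _ = Real.exp (-a) * ∑ h, P.real (A h) * Real.exp (S h) := (Finset.mul_sum _ _ _).symm
    _ ≤ Real.exp (-a) := mul_le_of_le_one_right (Real.exp_nonneg _)
        (sum_history_exp_le P T Z π X hlaw hX hsum T le_rfl)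

end Tail

/-! ### Bernstein moment bounds -/

/-- No lower bound on `x` is required. This matters because the gap between a reward and its
estimate is bounded above but can be very negative, of order `-1/q`. -/
lemma exp_le_one_add_add_sq {x : ℝ} (hx : x ≤ 1) : Real.exp x ≤ 1 + x + x ^ 2 := by
  by_cases h : -1 ≤ x
  · have := (abs_le.1 (Real.abs_exp_sub_one_sub_id_le (abs_le.2 ⟨h, hx⟩))).2
    linarith
  · have : Real.exp x ≤ 1 := Real.exp_le_one_iff.2 (by linarith)
    nlinarith

/-- Bernstein's bound on the exponential moment of a centred variable on a finite space. -/
lemma sum_mul_exp_sub_le_one {α : Type*} [Fintype α] (π Y : α → ℝ) (b : ℝ) (hπ : ∀ a, 0 ≤ π a)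
    (hπ1 : ∑ a, π a = 1) (hY : ∀ a, Y a ≤ 1) (hmean : ∑ a, π a * Y a = 0)
    (hvar : ∑ a, π a * Y a ^ 2 ≤ b) : ∑ a, π a * Real.exp (Y a - b) ≤ 1 := by
  have h1 : ∑ a, π a * Real.exp (Y a) ≤ 1 + b := by
    calc _ ≤ ∑ a, (π a + π a * Y a + π a * Y a ^ 2) :=
          Finset.sum_le_sum fun a _ => by
            nlinarith [mul_le_mul_of_nonneg_left (exp_le_one_add_add_sq (hY a)) (hπ a)]
      _ ≤ 1 + b := by
          rw [Finset.sum_add_distrib, Finset.sum_add_distrib, hπ1, hmean]; linarith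
  have h2 : ∑ a, π a * Real.exp (Y a - b) = (∑ a, π a * Real.exp (Y a)) * Real.exp (-b) := by
    rw [Finset.sum_mul]
    exact Finset.sum_congr rfl fun a _ => by rw [sub_eq_add_neg, Real.exp_add]; ring
  rw [h2]
  calc _ ≤ Real.exp b * Real.exp (-b) :=
        mul_le_mul_of_nonneg_right (h1.trans (by linarith [Real.add_one_le_exp b]))
          (Real.exp_nonneg _)
    _ = 1 := by rw [← Real.exp_add]; simp

/-! ### One round of the algorithm -/

section Round

variable {k : ℕ} {p : Fin k → ℝ}

lemma sum_sqrt_pos (hp : ∀ j, 0 < p j) (hp1 : ∑ j, p j = 1) : 0 < ∑ j, √(p j) := by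
  have : (Finset.univ : Finset (Fin k)).Nonempty := by
    by_contra h
    rw [Finset.not_nonempty_iff_eq_empty] at h
    simp [h] at hp1
  exact Finset.sum_pos (fun j _ => Real.sqrt_pos.2 (hp j)) this

lemma queryDist_pos (hp : ∀ j, 0 < p j) (hp1 : ∑ j, p j = 1) (j : Fin k) : 0 < queryDist p j :=
  div_pos (Real.sqrt_pos.2 (hp j)) (sum_sqrt_pos hp hp1)

lemma sum_queryDist (hp : ∀ j, 0 < p j) (hp1 : ∑ j, p j = 1) : ∑ j, queryDist p j = 1 := by
  unfold queryDist
  rw [← Finset.sum_div, div_self (sum_sqrt_pos hp hp1).ne']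

lemma sum_sqrt_le (hp : ∀ j, 0 < p j) (hp1 : ∑ j, p j = 1) : ∑ j, √(p j) ≤ √k := by
  apply Real.le_sqrt_of_sq_le
  have := sq_sum_le_card_mul_sum_sq (s := Finset.univ) (f := fun j => √(p j))
  simpa [Real.sq_sqrt (hp _).le, hp1] using this

lemma le_one_of_sum_eq_one (hp : ∀ j, 0 < p j) (hp1 : ∑ j, p j = 1) (j : Fin k) : p j ≤ 1 :=
  hp1 ▸ Finset.single_le_sum (fun i _ => (hp i).le) (Finset.mem_univ j)

lemma one_le_halfNorm (hp : ∀ j, 0 < p j) (hp1 : ∑ j, p j = 1) : 1 ≤ halfNorm p := by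
  have : 1 ≤ ∑ j, √(p j) := by
    rw [← hp1]
    exact Finset.sum_le_sum fun j _ =>
      Real.le_sqrt_of_sq_le (by nlinarith [hp j, le_one_of_sum_eq_one hp hp1 j])
  exact one_le_pow₀ this

lemma div_queryDist (hp : ∀ j, 0 < p j) (j : Fin k) :
    p j / queryDist p j = √(p j) * ∑ l, √(p l) := by
  have h := Real.sqrt_pos.2 (hp j)
  unfold queryDist
  rw [div_div_eq_mul_div]
  nth_rewrite 1 [← Real.mul_self_sqrt (hp j).le]
  field_simp

lemma sum_div_queryDist (hp : ∀ j, 0 < p j) : ∑ j, p j / queryDist p j = halfNorm p := by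
  simp only [div_queryDist hp, ← Finset.sum_mul, halfNorm, sq]

/-- The reason for querying in proportion to `√p`: the ratio no longer depends on `j`, so the
`p`-average of squared estimates has no factor that blows up on rare arms. -/
lemma div_queryDist_sq (hp : ∀ j, 0 < p j) (j : Fin k) :
    p j / queryDist p j ^ 2 = halfNorm p := by
  have h := Real.sqrt_pos.2 (hp j)
  rw [sq, ← div_div, div_queryDist hp, queryDist, halfNorm]
  field_simp

/-- Gives the range of the importance-weighted reward, hence the restriction `lam * √k ≤ 1` in its
Bernstein bound. -/
lemma div_queryDist_le (hp : ∀ j, 0 < p j) (hp1 : ∑ j, p j = 1) (j : Fin k) :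
    p j / queryDist p j ≤ √k := by
  rw [div_queryDist hp]
  calc _ ≤ 1 * √k := mul_le_mul (Real.sqrt_le_one.2 (le_one_of_sum_eq_one hp hp1 j))
        (sum_sqrt_le hp hp1) (sum_sqrt_pos hp hp1).le zero_le_one
    _ = √k := one_mul _

lemma sum_mul_rewardEstimate (hp : ∀ j, 0 < p j) (b : ℝ) (g : Fin k → ℝ) (j' : Fin k) :
    ∑ j, p j * rewardEstimate b (queryDist p) g j' j =
      p j' / queryDist p j' * g j' + b * halfNorm p := by
  have : ∀ j, p j * rewardEstimate b (queryDist p) g j' j =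
      (if j' = j then p j / queryDist p j * g j else 0) + b * (p j / queryDist p j) := by
    intro j
    unfold rewardEstimate
    split_ifs <;> ring
  simp only [this, Finset.sum_add_distrib, ← Finset.mul_sum, sum_div_queryDist hp]
  simp

/-- After factoring out `halfNorm p`, the queried arm contributes `g² + 2gb ≤ 1 + 2b ≤ (1 + b)² ≤
2`, and the bias contributes `b²` for each of the `k` arms. -/
lemma sum_mul_rewardEstimate_sq_le (hp : ∀ j, 0 < p j) {b : ℝ} (hb0 : 0 ≤ b)
    (hb : (1 + b) ^ 2 ≤ 2) {g : Fin k → ℝ} (hg : ∀ i, g i ∈ Set.Icc (0 : ℝ) 1) (j' : Fin k) :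
    ∑ j, p j * rewardEstimate b (queryDist p) g j' j ^ 2 ≤ (2 + k * b ^ 2) * halfNorm p := by
  have : ∀ j, p j * rewardEstimate b (queryDist p) g j' j ^ 2 =
      halfNorm p * ((if j' = j then g j ^ 2 + 2 * g j * b else 0) + b ^ 2) := by
    intro j
    rw [← div_queryDist_sq hp j]
    unfold rewardEstimate
    split_ifs <;> ring
  simp only [this, ← Finset.mul_sum, Finset.sum_add_distrib]
  simp only [Finset.sum_ite_eq, Finset.mem_univ, if_true, Finset.sum_const, Finset.card_univ,
    Fintype.card_fin, nsmul_eq_mul]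
  rw [mul_comm]
  refine mul_le_mul_of_nonneg_right ?_ (sq_nonneg _)
  obtain ⟨h0, h1⟩ := hg j'
  nlinarith [mul_nonneg h0 hb0, mul_nonneg (sub_nonneg.2 h1) hb0]

lemma sum_prod_mul_eq_one {q : Fin k → ℝ} (hp1 : ∑ j, p j = 1) (hq1 : ∑ j, q j = 1) :
    ∑ a : Fin k × Fin k, p a.1 * q a.2 = 1 := by
  rw [Fintype.sum_prod_type, ← Fintype.sum_mul_sum, hp1, hq1, one_mul]

/-- The exponential moment of the deviation between the reward of an arm and its estimate. -/
lemma sum_exp_sub_rewardEstimate_le (hp : ∀ j, 0 < p j) (hp1 : ∑ j, p j = 1) {b : ℝ}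
    (hb0 : 0 ≤ b) (hb1 : b ≤ 1) {g : Fin k → ℝ} (hg : ∀ i, g i ∈ Set.Icc (0 : ℝ) 1) (i : Fin k) :
    ∑ a : Fin k × Fin k, (p a.1 * queryDist p a.2) *
      Real.exp (b * (g i - rewardEstimate b (queryDist p) g a.2 i)) ≤ 1 := by
  have hq := queryDist_pos hp hp1
  have hq1 := sum_queryDist hp hp1
  set q := queryDist p with hqdef
  obtain ⟨h0, h1⟩ := hg i
  have hqi := hq i
  -- The number `b` is both the bias and the exponential scale. The bias therefore subtracts `b² / q
  -- i` in the exponent, exactly the variance bound. Only the query is random here; the action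
  -- integrates out.
  have key := sum_mul_exp_sub_le_one q (fun j => b * g i * (1 - if j = i then 1 / q i else 0))
    (b ^ 2 / q i) (fun j => (hq j).le) hq1 ?_ ?_ ?_
  · rw [Fintype.sum_prod_type]
    have : ∀ i' : Fin k, ∑ j, (p i' * q j) * Real.exp (b * (g i - rewardEstimate b q g j i)) =
        p i' * ∑ j, q j * Real.exp (b * g i * (1 - if j = i then 1 / q i else 0) - b ^ 2 / q i) := by
      intro i'
      rw [Finset.mul_sum]
      refine Finset.sum_congr rfl fun j _ => ?_
      rw [mul_assoc]
      congr 3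
      unfold rewardEstimate
      split_ifs <;> ring
    simp only [this, ← Finset.sum_mul, hp1, one_mul]
    exact key
  · intro j
    have hbg : b * g i ≤ 1 := mul_le_one₀ hb1 h0 h1
    have : (0 : ℝ) ≤ if j = i then 1 / q i else 0 := by split_ifs <;> positivity
    nlinarith [mul_nonneg hb0 h0]
  · have : ∀ j, q j * (b * g i * (1 - if j = i then 1 / q i else 0)) =
        b * g i * (q j - if j = i then 1 else 0) := by
      intro j
      split_ifs with h
      · subst h; field_simp
      · ring
    simp only [this, ← Finset.mul_sum, Finset.sum_sub_distrib, hq1]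
    simp
  · have : ∀ j, q j * (b * g i * (1 - if j = i then 1 / q i else 0)) ^ 2 =
        (b * g i) ^ 2 * (q j - 2 * (if j = i then 1 else 0) + if j = i then 1 / q i else 0) := by
      intro j
      split_ifs with h
      · subst h; field_simp; ring
      · ring
    simp only [this, ← Finset.mul_sum, Finset.sum_sub_distrib, Finset.sum_add_distrib, hq1]
    simp only [Finset.sum_ite_eq', Finset.mem_univ, if_true]
    have hgi : (b * g i) ^ 2 ≤ b ^ 2 := by
      rw [mul_pow]; exact mul_le_of_le_one_right (sq_nonneg _) (pow_le_one₀ h0 h1)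
    calc _ ≤ (b * g i) ^ 2 * (1 / q i) :=
          mul_le_mul_of_nonneg_left (by linarith) (sq_nonneg _)
      _ ≤ b ^ 2 * (1 / q i) := mul_le_mul_of_nonneg_right hgi (by positivity)
      _ = b ^ 2 / q i := by ring

/-- The exponential moment of the deviation between the importance-weighted estimate of the
algorithm's reward and the reward itself. -/
lemma sum_exp_weighted_sub_le (hp : ∀ j, 0 < p j) (hp1 : ∑ j, p j = 1) {lam : ℝ}
    (hl0 : 0 ≤ lam) (hl : lam * √k ≤ 1) {g : Fin k → ℝ} (hg : ∀ i, g i ∈ Set.Icc (0 : ℝ) 1) :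
    ∑ a : Fin k × Fin k, (p a.1 * queryDist p a.2) *
      Real.exp (lam * (p a.2 / queryDist p a.2 * g a.2 - g a.1) - 2 * lam ^ 2 * halfNorm p)
        ≤ 1 := by
  have hq := queryDist_pos hp hp1
  have hq1 := sum_queryDist hp hp1
  have hle := div_queryDist_le hp hp1
  have hH := one_le_halfNorm hp hp1
  have hsd := sum_div_queryDist hp
  set q := queryDist p with hqdef
  have hm : ∀ j, q j * (p j / q j * g j) = p j * g j := fun j => by
    have := hq j; field_simp
  refine sum_mul_exp_sub_le_one (fun a : Fin k × Fin k => p a.1 * q a.2)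
    (fun a => lam * (p a.2 / q a.2 * g a.2 - g a.1)) _
    (fun a => mul_nonneg (hp _).le (hq _).le) (sum_prod_mul_eq_one hp1 hq1) ?_ ?_ ?_
  · rintro ⟨i, j⟩
    have h1 : p j / q j * g j ≤ √k :=
      (mul_le_of_le_one_right (div_pos (hp j) (hq j)).le (hg j).2).trans (hle j)
    have h2 := (hg i).1
    calc lam * (p j / q j * g j - g i) ≤ lam * √k :=
          mul_le_mul_of_nonneg_left (by linarith) hl0
      _ ≤ 1 := hl
  · have : ∀ a : Fin k × Fin k, p a.1 * q a.2 * (lam * (p a.2 / q a.2 * g a.2 - g a.1)) =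
        lam * (p a.1 * (q a.2 * (p a.2 / q a.2 * g a.2)) - p a.1 * g a.1 * q a.2) :=
      fun a => by ring
    simp only [this, hm, ← Finset.mul_sum, Finset.sum_sub_distrib]
    simp only [Fintype.sum_prod_type]
    rw [← Fintype.sum_mul_sum, ← Fintype.sum_mul_sum (fun i => p i * g i), hp1, hq1]
    ring
  · have hbd : ∀ a : Fin k × Fin k,
        p a.1 * q a.2 * (lam * (p a.2 / q a.2 * g a.2 - g a.1)) ^ 2 ≤
        lam ^ 2 * (p a.1 * (p a.2 / q a.2) + p a.1 * q a.2) := by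
      rintro ⟨i, j⟩
      have hpj := hp j
      have hqj := hq j
      have hpi := hp i
      obtain ⟨hi0, hi1⟩ := hg i
      obtain ⟨hj0, hj1⟩ := hg j
      have hpj1 := le_one_of_sum_eq_one hp hp1 j
      have hx : 0 ≤ p j / q j := (div_pos hpj hqj).le
      -- The cross term is nonpositive and is dropped.
      have e1 : (p j / q j * g j - g i) ^ 2 ≤ (p j / q j) ^ 2 + 1 := by
        have a1 : 0 ≤ p j / q j * g j := mul_nonneg hx hj0
        have a2 : p j / q j * g j ≤ p j / q j := mul_le_of_le_one_right hx hj1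
        nlinarith [mul_nonneg a1 hi0]
      have e2 : q j * (p j / q j) ^ 2 ≤ p j / q j := by
        have : q j * (p j / q j) ^ 2 = p j * (p j / q j) := by field_simp
        rw [this]; exact mul_le_of_le_one_left hx hpj1
      calc p i * q j * (lam * (p j / q j * g j - g i)) ^ 2
          = lam ^ 2 * p i * q j * (p j / q j * g j - g i) ^ 2 := by ring
        _ ≤ lam ^ 2 * p i * q j * ((p j / q j) ^ 2 + 1) :=
            mul_le_mul_of_nonneg_left e1 (by positivity)
        _ = lam ^ 2 * p i * (q j * (p j / q j) ^ 2 + q j) := by ring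
        _ ≤ lam ^ 2 * p i * (p j / q j + q j) :=
            mul_le_mul_of_nonneg_left (by linarith) (by positivity)
        _ = _ := by ring
    refine (Finset.sum_le_sum fun a _ => hbd a).trans ?_
    rw [← Finset.mul_sum, Finset.sum_add_distrib, sum_prod_mul_eq_one hp1 hq1,
      Fintype.sum_prod_type]
    dsimp only
    rw [← Fintype.sum_mul_sum, hp1, hsd]
    -- The variance bound is `lam² (halfNorm p + 1)`; `1 ≤ halfNorm p` absorbs the constant into the
    -- factor 2.
    nlinarith [sq_nonneg lam]

end Round

/-! ### The parameters and the weights -/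

section Weights

variable {k T : ℕ} {μ δ : ℝ} {g : ℕ → Fin k → ℝ}

lemma eta_pos (hT : 1 ≤ T) (hμ : 1 ≤ μ) : 0 < eta T μ := by
  have : (1 : ℝ) ≤ T := by exact_mod_cast hT
  exact div_pos one_pos (Real.sqrt_pos.2 (by positivity))

lemma one_le_log (hk : 1 < k) (hδ : δ ∈ Set.Ioo (0 : ℝ) 1) : 1 ≤ Real.log (3 * k / δ) := by
  have hk' : (2 : ℝ) ≤ k := by exact_mod_cast hk
  obtain ⟨h0, h1⟩ := hδ
  rw [Real.le_log_iff_exp_le (by positivity), le_div_iff₀ h0]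
  have := Real.exp_one_lt_three
  nlinarith [Real.exp_pos 1]

lemma beta_pos (hk : 1 < k) (hT : 1 ≤ T) (hμ : 1 ≤ μ) (hδ : δ ∈ Set.Ioo (0 : ℝ) 1) :
    0 < beta k T μ δ := by
  have := one_le_log hk hδ
  have := eta_pos hT hμ
  unfold beta
  have : 0 < √(6 * Real.log (3 * k / δ)) := Real.sqrt_pos.2 (by linarith)
  positivity

lemma gamma_pos (hk : 1 < k) (hT : 1 ≤ T) (hμ : 1 ≤ μ) (hδ : δ ∈ Set.Ioo (0 : ℝ) 1) :
    0 < gamma k T μ δ := by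
  have := eta_pos hT hμ
  have := beta_pos hk hT hμ hδ
  have : (0 : ℝ) < k := by exact_mod_cast (by omega : 0 < k)
  unfold gamma
  positivity

lemma weight_pos (y : ℕ → Fin k) (t : ℕ) (j : Fin k) : 0 < weight k T μ δ g y t j := by
  induction t with
  | zero => simp [weight]
  | succ t ih => exact mul_pos ih (Real.exp_pos _)

/-- Predictability: it is what allows the tail bound to be applied to increments built from `p(t)`.
-/
lemma weight_congr {y y' : ℕ → Fin k} (t : ℕ) (h : ∀ s < t, y s = y' s) :
    weight k T μ δ g y t = weight k T μ δ g y' t := by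
  induction t with
  | zero => rfl
  | succ t ih =>
    simp only [weight]
    rw [ih fun s hs => h s (by omega), h t (by omega)]

lemma pVec_congr {y y' : ℕ → Fin k} (t : ℕ) (h : ∀ s < t, y s = y' s) :
    pVec k T μ δ g y t = pVec k T μ δ g y' t := by
  unfold pVec
  rw [weight_congr t h]

lemma sum_weight_pos (hk : 1 < k) (y : ℕ → Fin k) (t : ℕ) :
    0 < ∑ l, weight k T μ δ g y t l :=
  Finset.sum_pos (fun l _ => weight_pos y t l) ⟨⟨0, by omega⟩, Finset.mem_univ _⟩

lemma div_le_pVec (hk : 1 < k) (hγ1 : gamma k T μ δ ≤ 1) (y : ℕ → Fin k)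
    (t : ℕ) (j : Fin k) : gamma k T μ δ / k ≤ pVec k T μ δ g y t j := by
  have := div_pos (weight_pos (T := T) (μ := μ) (δ := δ) (g := g) y t j)
    (sum_weight_pos (T := T) (μ := μ) (δ := δ) (g := g) hk y t)
  unfold pVec actionDist
  nlinarith [mul_nonneg (sub_nonneg.2 hγ1) this.le]

lemma pVec_pos (hk : 1 < k) (hγ : 0 < gamma k T μ δ) (hγ1 : gamma k T μ δ ≤ 1) (y : ℕ → Fin k)
    (t : ℕ) (j : Fin k) : 0 < pVec k T μ δ g y t j := by
  have hk' : (0 : ℝ) < k := by exact_mod_cast (by omega : 0 < k)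
  exact (div_pos hγ hk').trans_le (div_le_pVec hk hγ1 y t j)

lemma sum_pVec (hk : 1 < k) (y : ℕ → Fin k) (t : ℕ) : ∑ j, pVec k T μ δ g y t j = 1 := by
  have hk' : (k : ℝ) ≠ 0 := by exact_mod_cast (by omega : k ≠ 0)
  unfold pVec actionDist
  rw [Finset.sum_add_distrib, ← Finset.mul_sum, ← Finset.sum_div,
    div_self (sum_weight_pos hk y t).ne']
  simp [mul_div_cancel₀ _ hk']

/-- The exploration parameter keeps the scaled reward estimates below one. -/
lemma eta_mul_rewardEstimate_le_one (hk : 1 < k) (hT : 1 ≤ T) (hμ : 1 ≤ μ)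
    (hδ : δ ∈ Set.Ioo (0 : ℝ) 1) (hγ1 : gamma k T μ δ ≤ 1) (y : ℕ → Fin k) (t : ℕ)
    (hg : ∀ i, g t i ∈ Set.Icc (0 : ℝ) 1) (j' j : Fin k) :
    eta T μ * rewardEstimate (beta k T μ δ) (qVec k T μ δ g y t) (g t) j' j ≤ 1 := by
  have hη := eta_pos hT hμ
  have hβ := beta_pos hk hT hμ hδ
  have hγ := gamma_pos hk hT hμ hδ
  have hp := pVec_pos (g := g) hk hγ hγ1 y t
  have hp1 := sum_pVec (T := T) (μ := μ) (δ := δ) (g := g) hk y t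
  have hk' : (0 : ℝ) < k := by exact_mod_cast (by omega : 0 < k)
  -- Exploration gives `√p_j ≥ √(γ/k)`, while the normalisation of `q` is at most `√k`. The value of
  -- `γ` is chosen so that the quotient `√γ / k` equals `η(1 + β)`.
  have hq : eta T μ * (1 + beta k T μ δ) ≤ qVec k T μ δ g y t j := by
    unfold qVec queryDist
    rw [le_div_iff₀ (sum_sqrt_pos hp hp1)]
    calc _ ≤ eta T μ * (1 + beta k T μ δ) * √k :=
          mul_le_mul_of_nonneg_left (sum_sqrt_le hp hp1) (by positivity)
      _ = √((eta T μ * (1 + beta k T μ δ)) ^ 2 * k) := by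
          rw [Real.sqrt_mul (sq_nonneg _), Real.sqrt_sq (by positivity)]
      _ = √(gamma k T μ δ / k) := by
          congr 1; unfold gamma; field_simp
      _ ≤ _ := Real.sqrt_le_sqrt (div_le_pVec hk hγ1 y t j)
  have hq0 : 0 < qVec k T μ δ g y t j := lt_of_lt_of_le (by positivity) hq
  unfold rewardEstimate
  have hb : (if j' = j then g t j else 0) + beta k T μ δ ≤ 1 + beta k T μ δ := by
    split_ifs
    · linarith [(hg j).2]
    · linarith
  rw [one_div_mul_eq_div, ← mul_div_assoc, div_le_one hq0]
  exact (mul_le_mul_of_nonneg_left hb hη.le).trans hq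

lemma log_weight (y : ℕ → Fin k) (t : ℕ) (i : Fin k) :
    Real.log (weight k T μ δ g y t i) = eta T μ * ∑ s ∈ Finset.range t,
      rewardEstimate (beta k T μ δ) (qVec k T μ δ g y s) (g s) (y s) i := by
  induction t with
  | zero => simp [weight]
  | succ t ih =>
    rw [weight, Real.log_mul (weight_pos y t i).ne' (Real.exp_pos _).ne', Real.log_exp, ih,
      Finset.sum_range_succ, mul_add]
    rfl

/-- The potential bound for exponential weights. -/
lemma log_sum_weight_le (hk : 1 < k) (hT : 1 ≤ T) (hμ : 1 ≤ μ)
    (hδ : δ ∈ Set.Ioo (0 : ℝ) 1) (hγ1 : gamma k T μ δ ≤ 1) (y : ℕ → Fin k)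
    (hg : ∀ t < T, ∀ i, g t i ∈ Set.Icc (0 : ℝ) 1) (t : ℕ) (ht : t ≤ T) :
    (1 - gamma k T μ δ) * Real.log (∑ l, weight k T μ δ g y t l) ≤
      (1 - gamma k T μ δ) * Real.log k + ∑ s ∈ Finset.range t, ∑ j, pVec k T μ δ g y s j *
        (eta T μ * rewardEstimate (beta k T μ δ) (qVec k T μ δ g y s) (g s) (y s) j +
        (eta T μ * rewardEstimate (beta k T μ δ) (qVec k T μ δ g y s) (g s) (y s) j) ^ 2) := by
  induction t with
  | zero => simp [weight]
  | succ t ih =>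
    have hη := eta_pos hT hμ
    have hγ := gamma_pos hk hT hμ hδ
    have hk' : (0 : ℝ) < k := by exact_mod_cast (by omega : 0 < k)
    have hp := pVec_pos (g := g) hk hγ hγ1 y t
    have hp1 := sum_pVec (T := T) (μ := μ) (δ := δ) (g := g) hk y t
    have hq : ∀ j, 0 < qVec k T μ δ g y t j := queryDist_pos hp hp1
    have hW := sum_weight_pos (T := T) (μ := μ) (δ := δ) (g := g) hk y t
    have hW' := sum_weight_pos (T := T) (μ := μ) (δ := δ) (g := g) hk y (t + 1)
    have hβ := beta_pos hk hT hμ hδ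
    set W := ∑ l, weight k T μ δ g y t l with hWdef
    set e : Fin k → ℝ := fun j =>
      eta T μ * rewardEstimate (beta k T μ δ) (qVec k T μ δ g y t) (g t) (y t) j with he
    have he1 : ∀ j, e j ≤ 1 := fun j =>
      eta_mul_rewardEstimate_le_one hk hT hμ hδ hγ1 y t (hg t (by omega)) (y t) j
    have he0 : ∀ j, 0 ≤ e j := fun j => by
      have h1 := hq j
      have h2 := (hg t (by omega) j).1
      have : 0 ≤ (if y t = j then g t j else 0) + beta k T μ δ := by split_ifs <;> positivity
      simp only [he, rewardEstimate]
      positivity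
    have hstep : ∑ l, weight k T μ δ g y (t + 1) l ≤
        W * (1 + ∑ j, weight k T μ δ g y t j / W * (e j + e j ^ 2)) := by
      calc _ = ∑ l, weight k T μ δ g y t l * Real.exp (e l) := rfl
        _ ≤ ∑ l, weight k T μ δ g y t l * (1 + e l + e l ^ 2) :=
            Finset.sum_le_sum fun l _ => mul_le_mul_of_nonneg_left
              (exp_le_one_add_add_sq (he1 l)) (weight_pos y t l).le
        _ = _ := by
            rw [mul_add, mul_one, Finset.mul_sum]
            nth_rewrite 1 [hWdef]
            rw [← Finset.sum_add_distrib]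
            refine Finset.sum_congr rfl fun l _ => ?_
            field_simp
            ring
    have hpos : 0 ≤ ∑ j, weight k T μ δ g y t j / W * (e j + e j ^ 2) :=
      Finset.sum_nonneg fun j _ => mul_nonneg (div_nonneg (weight_pos y t j).le hW.le)
        (add_nonneg (he0 j) (sq_nonneg _))
    have hlog : Real.log (∑ l, weight k T μ δ g y (t + 1) l) ≤
        Real.log W + ∑ j, weight k T μ δ g y t j / W * (e j + e j ^ 2) := by
      refine (Real.log_le_log hW' hstep).trans ?_
      rw [Real.log_mul hW.ne' (by positivity)]
      have := Real.log_le_sub_one_of_pos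
        (show 0 < 1 + ∑ j, weight k T μ δ g y t j / W * (e j + e j ^ 2) by positivity)
      linarith
    -- Since `(1 - γ) w/W ≤ p` and the summands are nonnegative, the normalised weights can be
    -- replaced by `p`. Keeping `1 - γ` as a factor avoids a division that fails at `γ = 1`.
    have hmul : (1 - gamma k T μ δ) * ∑ j, weight k T μ δ g y t j / W * (e j + e j ^ 2) ≤
        ∑ j, pVec k T μ δ g y t j * (e j + e j ^ 2) := by
      rw [Finset.mul_sum]
      refine Finset.sum_le_sum fun j _ => ?_
      rw [← mul_assoc]
      refine mul_le_mul_of_nonneg_right ?_ (add_nonneg (he0 j) (sq_nonneg _))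
      unfold pVec actionDist
      have : 0 ≤ gamma k T μ δ / k := by positivity
      linarith
    rw [Finset.sum_range_succ]
    have := mul_le_mul_of_nonneg_left hlog (sub_nonneg.2 hγ1)
    have := ih (by omega)
    nlinarith

/-- The deterministic regret bound of the algorithm against the reward estimates. -/
lemma sum_rewardEstimate_le (hk : 1 < k) (hT : 1 ≤ T) (hμ : 1 ≤ μ)
    (hδ : δ ∈ Set.Ioo (0 : ℝ) 1) (hγ1 : gamma k T μ δ ≤ 1) (hβ2 : (1 + beta k T μ δ) ^ 2 ≤ 2)
    (y : ℕ → Fin k) (hg : ∀ t < T, ∀ i, g t i ∈ Set.Icc (0 : ℝ) 1) (i : Fin k) :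
    (1 - gamma k T μ δ) * ∑ t ∈ Finset.range T,
        rewardEstimate (beta k T μ δ) (qVec k T μ δ g y t) (g t) (y t) i ≤
      Real.log k / eta T μ +
        ∑ t ∈ Finset.range T, pVec k T μ δ g y t (y t) / qVec k T μ δ g y t (y t) * g t (y t) +
        (beta k T μ δ + eta T μ * (2 + k * beta k T μ δ ^ 2)) *
          ∑ t ∈ Finset.range T, halfNorm (pVec k T μ δ g y t) := by
  have hη := eta_pos hT hμ
  have hγ := gamma_pos hk hT hμ hδ
  have hβ := beta_pos hk hT hμ hδ
  have hpot := log_sum_weight_le hk hT hμ hδ hγ1 y hg T le_rfl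
  have hlow : Real.log (weight k T μ δ g y T i) ≤ Real.log (∑ l, weight k T μ δ g y T l) :=
    Real.log_le_log (weight_pos y T i)
      (Finset.single_le_sum (fun l _ => (weight_pos y T l).le) (Finset.mem_univ i))
  rw [log_weight] at hlow
  have hlow' := mul_le_mul_of_nonneg_left hlow (sub_nonneg.2 hγ1)
  have hlogk : 0 ≤ Real.log k := Real.log_natCast_nonneg k
  have hround : ∑ s ∈ Finset.range T, ∑ j, pVec k T μ δ g y s j *
        (eta T μ * rewardEstimate (beta k T μ δ) (qVec k T μ δ g y s) (g s) (y s) j +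
        (eta T μ * rewardEstimate (beta k T μ δ) (qVec k T μ δ g y s) (g s) (y s) j) ^ 2) ≤
      eta T μ * (∑ t ∈ Finset.range T,
          pVec k T μ δ g y t (y t) / qVec k T μ δ g y t (y t) * g t (y t) +
        (beta k T μ δ + eta T μ * (2 + k * beta k T μ δ ^ 2)) *
          ∑ t ∈ Finset.range T, halfNorm (pVec k T μ δ g y t)) := by
    rw [Finset.mul_sum (s := Finset.range T) (f := fun t => halfNorm (pVec k T μ δ g y t)),
      ← Finset.sum_add_distrib, Finset.mul_sum]
    refine Finset.sum_le_sum fun t ht => ?_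
    have hp := pVec_pos (g := g) hk hγ hγ1 y t
    have h1 := sum_mul_rewardEstimate hp (beta k T μ δ) (g t) (y t)
    have h2 := sum_mul_rewardEstimate_sq_le hp hβ.le hβ2 (hg t (Finset.mem_range.1 ht)) (y t)
    calc _ = eta T μ * ∑ j, pVec k T μ δ g y t j *
            rewardEstimate (beta k T μ δ) (qVec k T μ δ g y t) (g t) (y t) j +
          eta T μ ^ 2 * ∑ j, pVec k T μ δ g y t j *
            rewardEstimate (beta k T μ δ) (qVec k T μ δ g y t) (g t) (y t) j ^ 2 := by
          rw [Finset.mul_sum, Finset.mul_sum, ← Finset.sum_add_distrib]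
          exact Finset.sum_congr rfl fun j _ => by ring
      _ ≤ _ := by
          unfold qVec
          rw [h1]
          nlinarith [mul_le_mul_of_nonneg_left h2 (sq_nonneg (eta T μ))]
  have hfin : eta T μ * ((1 - gamma k T μ δ) * ∑ t ∈ Finset.range T,
        rewardEstimate (beta k T μ δ) (qVec k T μ δ g y t) (g t) (y t) i) ≤
      eta T μ * (Real.log k / eta T μ + (∑ t ∈ Finset.range T,
          pVec k T μ δ g y t (y t) / qVec k T μ δ g y t (y t) * g t (y t) +
        (beta k T μ δ + eta T μ * (2 + k * beta k T μ δ ^ 2)) *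
          ∑ t ∈ Finset.range T, halfNorm (pVec k T μ δ g y t))) := by
    rw [mul_add, mul_div_cancel₀ _ hη.ne']
    nlinarith [mul_nonneg hγ.le hlogk]
  have := le_of_mul_le_mul_left hfin hη
  linarith

end Weights

/-! ### The regret bound -/

section Regret

variable {k T : ℕ} {μ δ v : ℝ} {g : ℕ → Fin k → ℝ}

set_option maxHeartbeats 1000000 in
/-- The deviations allowed on the good event add up to the regret bound. -/
lemma parameter_bound (hk : 1 < k) (hT : 1 ≤ T) (hμ : μ ∈ Set.Icc (1 : ℝ) k)
    (hδ : δ ∈ Set.Ioo (0 : ℝ) 1) (hv : v ∈ Set.Icc (1 : ℝ) k)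
    (hβ2 : (1 + beta k T μ δ) ^ 2 ≤ 2) :
    gamma k T μ δ * T + Real.log (3 * k / δ) / beta k T μ δ + Real.log k / eta T μ +
      (beta k T μ δ + eta T μ * (2 + k * beta k T μ δ ^ 2)) * (v * T) +
      (2 * (1 / (√(v * T) + √k)) * (v * T) + Real.log (3 * k / δ) * (√(v * T) + √k)) ≤
    40 * Real.log (3 * k / δ) * (√((v ^ 2 / μ + μ + v) * T) + (k : ℝ) ^ 2 / μ) := by
  have hL := one_le_log hk hδ
  have hη := eta_pos hT hμ.1
  have hβ := beta_pos hk hT hμ.1 hδ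
  have hk2 : (2 : ℝ) ≤ k := by exact_mod_cast hk
  have hT1 : (1 : ℝ) ≤ T := by exact_mod_cast hT
  have hlogk : Real.log k ≤ Real.log (3 * k / δ) := by
    refine Real.log_le_log (by linarith) ?_
    rw [le_div_iff₀ hδ.1]
    nlinarith [hδ.2]
  obtain ⟨hμ1, hμk⟩ := hμ
  obtain ⟨hv1, hvk⟩ := hv
  set L := Real.log (3 * k / δ) with hLdef
  set A := √((v ^ 2 / μ + μ + v) * T) with hA
  set B := (k : ℝ) ^ 2 / μ with hB
  have hv2 : 0 ≤ v ^ 2 / μ := by positivity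
  have hA0 : 0 ≤ A := Real.sqrt_nonneg _
  have hkB : (k : ℝ) ≤ B := by
    rw [hB, le_div_iff₀ (by linarith)]; nlinarith
  have hAμ : √(μ * T) ≤ A := Real.sqrt_le_sqrt (by nlinarith)
  have hAv : √(v * T) ≤ A := Real.sqrt_le_sqrt (by nlinarith)
  have hs0 : 0 < √(μ * T) := Real.sqrt_pos.2 (by positivity)
  have hsq : √(μ * T) ^ 2 = μ * T := Real.sq_sqrt (by positivity)
  have hs1 : 1 ≤ √(μ * T) := Real.one_le_sqrt.2 (by nlinarith)
  have hηs : eta T μ = 1 / √(μ * T) := rfl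
  have hη2 : eta T μ ^ 2 = 1 / (μ * T) := by rw [hηs, div_pow, hsq, one_pow]
  have hvs : eta T μ * (v * T) ≤ A := by
    apply Real.le_sqrt_of_sq_le
    have : (eta T μ * (v * T)) ^ 2 = v ^ 2 / μ * T := by
      rw [mul_pow, hη2]; field_simp
    rw [this]; nlinarith
  have hr0 : 0 ≤ √(6 * L) := Real.sqrt_nonneg _
  have hrsq : √(6 * L) ^ 2 = 6 * L := Real.sq_sqrt (by linarith)
  have hr1 : 1 ≤ √(6 * L) := Real.one_le_sqrt.2 (by linarith)
  have hrL : √(6 * L) ≤ 3 * L := Real.sqrt_le_iff.2 ⟨by linarith, by nlinarith⟩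
  have hβdef : beta k T μ δ = 2 * eta T μ * √(6 * L) := rfl
  have t1 : gamma k T μ δ * T ≤ 2 * B := by
    have : gamma k T μ δ * T = (1 + beta k T μ δ) ^ 2 * B := by
      unfold gamma; rw [hη2, hB]; field_simp
    rw [this]; exact mul_le_mul_of_nonneg_right hβ2 (by linarith)
  have t2 : L / beta k T μ δ ≤ L * A := by
    have : L / beta k T μ δ = L * √(μ * T) / (2 * √(6 * L)) := by
      rw [hβdef, hηs]; field_simp
    rw [this, div_le_iff₀ (by linarith)]
    have : L * √(μ * T) ≤ L * A := mul_le_mul_of_nonneg_left hAμ (by linarith)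
    have hLA0 : 0 ≤ L * A := mul_nonneg (by linarith) hA0
    linarith [mul_le_mul_of_nonneg_left hr1 hLA0]
  have t3 : Real.log k / eta T μ ≤ L * A := by
    rw [hηs, div_div_eq_mul_div, div_one]
    exact mul_le_mul hlogk hAμ hs0.le (by linarith)
  have t4 : beta k T μ δ * (v * T) ≤ 6 * (L * A) := by
    have : beta k T μ δ * (v * T) = 2 * √(6 * L) * (eta T μ * (v * T)) := by rw [hβdef]; ring
    rw [this]
    calc _ ≤ 2 * (3 * L) * A := mul_le_mul (by linarith) hvs (by positivity) (by linarith)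
      _ = _ := by ring
  -- Since `β²` carries `η² = 1/(μT)`, the factor `T` cancels; then `v ≤ k` and `η ≤ 1` leave a
  -- multiple of `L k²/μ`.
  have t5 : eta T μ * (k * beta k T μ δ ^ 2) * (v * T) ≤ 24 * (L * B) := by
    have : eta T μ * (k * beta k T μ δ ^ 2) * (v * T) =
        eta T μ * (24 * (L * (k * v / μ))) := by
      rw [hβdef, mul_pow, hrsq, mul_pow, hη2]; field_simp; ring
    rw [this]
    have hη1 : eta T μ ≤ 1 := by rw [hηs, div_le_one hs0]; exact hs1
    have hkv : k * v / μ ≤ B := by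
      rw [hB]; exact div_le_div_of_nonneg_right (by nlinarith) (by linarith)
    calc _ ≤ 1 * (24 * (L * (k * v / μ))) :=
          mul_le_mul_of_nonneg_right hη1 (by positivity)
      _ ≤ _ := by linarith [mul_le_mul_of_nonneg_left hkv (by linarith : 0 ≤ L)]
  have hw0 : 0 < √(v * T) := Real.sqrt_pos.2 (by positivity)
  have hwsq : √(v * T) ^ 2 = v * T := Real.sq_sqrt (by positivity)
  -- In the scale `1/(√(vT) + √k)`, the term `√(vT)` balances variance against `log(3k/δ)`, and `√k`
  -- ensures the range condition of the Bernstein bound.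
  have t6 : 2 * (1 / (√(v * T) + √k)) * (v * T) ≤ 2 * A := by
    have : 1 / (√(v * T) + √k) * (v * T) ≤ √(v * T) := by
      rw [one_div_mul_eq_div, div_le_iff₀ (by positivity)]
      linarith [mul_nonneg hw0.le (Real.sqrt_nonneg (k : ℝ)), sq √(v * T),
        mul_add √(v * T) √(v * T) √k]
    linarith
  have t7 : L * (√(v * T) + √k) ≤ L * (A + B) := by
    have : √(k : ℝ) ≤ k := Real.sqrt_le_iff.2 ⟨by linarith, by nlinarith⟩
    exact mul_le_mul_of_nonneg_left (by linarith) (by linarith)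
  have hLA : A ≤ L * A := le_mul_of_one_le_left hA0 hL
  have hLB : B ≤ L * B := le_mul_of_one_le_left (by linarith) hL
  -- The terms add up to at most `13 * (L * A) + 27 * (L * B)`, so the constant 40 leaves room.
  linarith

/-- The good event implies the regret bound. -/
lemma regret_le_of_estimates (hk : 1 < k) (hT : 1 ≤ T) (hμ : μ ∈ Set.Icc (1 : ℝ) k)
    (hδ : δ ∈ Set.Ioo (0 : ℝ) 1) (hv : v ∈ Set.Icc (1 : ℝ) k)
    (hg : ∀ t < T, ∀ i, g t i ∈ Set.Icc (0 : ℝ) 1)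
    (hβ2 : (1 + beta k T μ δ) ^ 2 ≤ 2) (hγ1 : gamma k T μ δ ≤ 1) (x y : ℕ → Fin k)
    (hest : ∀ i, ∑ t ∈ Finset.range T, beta k T μ δ *
      (g t i - rewardEstimate (beta k T μ δ) (qVec k T μ δ g y t) (g t) (y t) i) ≤
        Real.log (3 * k / δ))
    (hdev : ∑ t ∈ Finset.range T, ((1 / (√(v * T) + √k)) *
      (pVec k T μ δ g y t (y t) / qVec k T μ δ g y t (y t) * g t (y t) - g t (x t)) -
        2 * (1 / (√(v * T) + √k)) ^ 2 * halfNorm (pVec k T μ δ g y t)) ≤ Real.log (3 * k / δ))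
    (hnorm : 1 / (T : ℝ) * ∑ t ∈ Finset.range T, halfNorm (pVec k T μ δ g y t) ≤ v) :
    regret T g x ≤
      40 * Real.log (3 * k / δ) * (√((v ^ 2 / μ + μ + v) * T) + (k : ℝ) ^ 2 / μ) := by
  have hη := eta_pos hT hμ.1
  have hβ := beta_pos hk hT hμ.1 hδ
  have hγ := gamma_pos hk hT hμ.1 hδ
  have hL := one_le_log hk hδ
  have hT1 : (1 : ℝ) ≤ T := by exact_mod_cast hT
  have hk2 : (2 : ℝ) ≤ k := by exact_mod_cast hk
  have hpar := parameter_bound hk hT hμ hδ hv hβ2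
  have hlam : 0 < √(v * T) + √k :=
    add_pos_of_nonneg_of_pos (Real.sqrt_nonneg _) (Real.sqrt_pos.2 (by linarith))
  set D := √(v * T) + √k with hD
  set H := ∑ t ∈ Finset.range T, halfNorm (pVec k T μ δ g y t) with hH
  set L := Real.log (3 * k / δ) with hLdef
  set R := 40 * L * (√((v ^ 2 / μ + μ + v) * T) + (k : ℝ) ^ 2 / μ) with hR
  have hHv : H ≤ v * T := by
    rwa [one_div_mul_eq_div, div_le_iff₀ (by linarith)] at hnorm
  rw [Finset.sum_sub_distrib, ← Finset.mul_sum, ← Finset.mul_sum, Finset.sum_sub_distrib,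
    ← hH] at hdev
  set Z := ∑ t ∈ Finset.range T,
    pVec k T μ δ g y t (y t) / qVec k T μ δ g y t (y t) * g t (y t) with hZ
  set G := ∑ t ∈ Finset.range T, g t (x t) with hG
  have hdev' : Z - G ≤ 2 * (1 / D) * (v * T) + L * D := by
    have h1 : Z - G = D * (1 / D * (Z - G)) := by field_simp
    have h2 : D * (2 * (1 / D) ^ 2 * H) = 2 * (1 / D) * H := by field_simp
    have h3 : 2 * (1 / D) * H ≤ 2 * (1 / D) * (v * T) :=
      mul_le_mul_of_nonneg_left hHv (by positivity)
    have h4 := mul_le_mul_of_nonneg_left hdev hlam.le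
    rw [mul_sub, ← h1, h2] at h4
    linarith
  have hcoef : 0 ≤ beta k T μ δ + eta T μ * (2 + k * beta k T μ δ ^ 2) := by positivity
  have hcH := mul_le_mul_of_nonneg_left hHv hcoef
  have hmain : ∀ i, ∑ t ∈ Finset.range T, g t i ≤ R + G := by
    intro i
    have h1 := sum_rewardEstimate_le hk hT hμ.1 hδ hγ1 hβ2 y hg i
    have h2 := hest i
    rw [← Finset.mul_sum, Finset.sum_sub_distrib, mul_comm, ← le_div_iff₀ hβ] at h2
    have h3 : ∑ t ∈ Finset.range T, g t i ≤ T := by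
      calc _ ≤ ∑ t ∈ Finset.range T, (1 : ℝ) :=
            Finset.sum_le_sum fun t ht => (hg t (Finset.mem_range.1 ht) i).2
        _ = T := by simp
    have h4 := mul_le_mul_of_nonneg_left h2 (sub_nonneg.2 hγ1)
    have h5 := mul_le_mul_of_nonneg_left h3 hγ.le
    have h6 : 0 ≤ gamma k T μ δ * (L / beta k T μ δ) := by positivity
    -- The total reward of arm `i` is split by the factors `1 - γ` and `γ`: the first part is
    -- compared with its estimate at cost at most `L/β`, and the second is at most `γT`.
    linarith
  have : Nonempty (Fin k) := ⟨⟨0, by omega⟩⟩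
  unfold regret
  have := ciSup_le hmain
  linarith

lemma regret_le_rounds (hk : 1 < k) (hg : ∀ t < T, ∀ i, g t i ∈ Set.Icc (0 : ℝ) 1)
    (x : ℕ → Fin k) : regret T g x ≤ T := by
  have : Nonempty (Fin k) := ⟨⟨0, by omega⟩⟩
  have h1 : (⨆ i, ∑ t ∈ Finset.range T, g t i) ≤ T := ciSup_le fun i => by
    calc _ ≤ ∑ t ∈ Finset.range T, (1 : ℝ) :=
          Finset.sum_le_sum fun t ht => (hg t (Finset.mem_range.1 ht) i).2
      _ = T := by simp
  have h2 : 0 ≤ ∑ t ∈ Finset.range T, g t (x t) :=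
    Finset.sum_nonneg fun t ht => (hg t (Finset.mem_range.1 ht) _).1
  unfold regret
  linarith

/-- Here `p(t)` need not be a probability vector, but `T ≤ γT = (1 + β)² k²/μ ≤ 2k²/μ`, so the
trivial regret bound `T` is enough. -/
lemma regret_le_of_one_lt_gamma (hk : 1 < k) (hT : 1 ≤ T) (hμ : 1 ≤ μ)
    (hδ : δ ∈ Set.Ioo (0 : ℝ) 1) (hg : ∀ t < T, ∀ i, g t i ∈ Set.Icc (0 : ℝ) 1)
    (hβ2 : (1 + beta k T μ δ) ^ 2 ≤ 2) (hγ1 : 1 < gamma k T μ δ) (x : ℕ → Fin k) :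
    regret T g x ≤
      40 * Real.log (3 * k / δ) * (√((v ^ 2 / μ + μ + v) * T) + (k : ℝ) ^ 2 / μ) := by
  have hL := one_le_log hk hδ
  have hT1 : (1 : ℝ) ≤ T := by exact_mod_cast hT
  have h1 : gamma k T μ δ * T = (1 + beta k T μ δ) ^ 2 * ((k : ℝ) ^ 2 / μ) := by
    unfold gamma eta
    rw [div_pow, Real.sq_sqrt (by positivity)]; field_simp
  have hB : 0 ≤ (k : ℝ) ^ 2 / μ := by positivity
  have hA : 0 ≤ √((v ^ 2 / μ + μ + v) * T) := Real.sqrt_nonneg _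
  have h2 : (T : ℝ) ≤ 2 * ((k : ℝ) ^ 2 / μ) := by
    calc (T : ℝ) ≤ gamma k T μ δ * T := le_mul_of_one_le_left (by linarith) hγ1.le
      _ ≤ _ := by rw [h1]; exact mul_le_mul_of_nonneg_right hβ2 hB
  refine (regret_le_rounds hk hg x).trans (h2.trans ?_)
  calc 2 * ((k : ℝ) ^ 2 / μ) ≤ 40 * Real.log (3 * k / δ) * ((k : ℝ) ^ 2 / μ) :=
        mul_le_mul_of_nonneg_right (by linarith) hB
    _ ≤ _ := mul_le_mul_of_nonneg_left (by linarith) (by linarith)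

/-- The exponential tail bound for a run of the algorithm. -/
lemma IsRun.measure_lt_sum_le {Ω : Type*} [MeasurableSpace Ω] {P : Measure Ω}
    [IsProbabilityMeasure P] {I J : ℕ → Ω → Fin k} (hrun : IsRun P k T μ δ g I J) (hk : 1 < k)
    (hδ : δ ∈ Set.Ioo (0 : ℝ) 1) (F : ℕ → (Fin k → ℝ) → Fin k × Fin k → ℝ)
    (hF : ∀ t < T, ∀ y : ℕ → Fin k, ∑ a : Fin k × Fin k,
      (pVec k T μ δ g y t a.1 * queryDist (pVec k T μ δ g y t) a.2) *
        Real.exp (F t (pVec k T μ δ g y t) a) ≤ 1) :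
    P.real {ω | Real.log (3 * k / δ) < ∑ t ∈ Finset.range T,
      F t (pVec k T μ δ g (fun s => J s ω) t) (I t ω, J t ω)} ≤ δ / (3 * k) := by
  have : Inhabited (Fin k) := ⟨⟨0, by omega⟩⟩
  have hk' : (0 : ℝ) < k := by exact_mod_cast (by omega : 0 < k)
  have hexp : Real.exp (-Real.log (3 * k / δ)) = δ / (3 * k) := by
    have := hδ.1
    rw [Real.exp_neg, Real.exp_log (by positivity), inv_div]
  rw [← hexp]
  refine measure_lt_sum_le_exp_neg P T (fun t ω => (I t ω, J t ω))
    (fun t z a => pVec k T μ δ g (fun s => (z s).2) t a.1 *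
      qVec k T μ δ g (fun s => (z s).2) t a.2)
    (fun t z a => F t (pVec k T μ δ g (fun s => (z s).2) t) a) ?_ ?_ ?_ _
  · intro t ht z a
    have := hrun.law t ht (fun s => (z s).1) (fun s => (z s).2) a.1 a.2
    simpa only [Prod.ext_iff] using this
  · intro t z z' h
    have : pVec k T μ δ g (fun s => (z s).2) t = pVec k T μ δ g (fun s => (z' s).2) t :=
      pVec_congr t fun s hs => by rw [h s hs]
    simp only [this]
  · intro t ht z
    exact hF t ht _

end Regret

end DecoupledMAB

/-! ### The theorem: union bound over the bad events -/

theorem theorem1 :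
    ∃ C : ℝ, 0 < C ∧
      ∀ (k T : ℕ) (μ δ v : ℝ) (g : ℕ → Fin k → ℝ),
        1 < k → 1 ≤ T → μ ∈ Set.Icc (1 : ℝ) k → δ ∈ Set.Ioo (0 : ℝ) 1 →
        v ∈ Set.Icc (1 : ℝ) k →
        (∀ t < T, ∀ i, g t i ∈ Set.Icc (0 : ℝ) 1) →
        (1 + DecoupledMAB.beta k T μ δ) ^ 2 ≤ 2 →
        ∀ (Ω : Type*) [MeasurableSpace Ω] (P : Measure Ω) [IsProbabilityMeasure P]
          (I J : ℕ → Ω → Fin k),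
          DecoupledMAB.IsRun P k T μ δ g I J →
          1 - δ - DecoupledMAB.excessProb P k T μ δ g J v ≤
            P.real {ω | DecoupledMAB.regret T g (fun t => I t ω) ≤
              C * Real.log (3 * k / δ) *
                (√((v ^ 2 / μ + μ + v) * T) + (k : ℝ) ^ 2 / μ +
                  (k : ℝ) ^ 2 / (T : ℝ) ^ (3 / 2 : ℝ))} := by
  classical
  refine ⟨40, by norm_num, ?_⟩
  intro k T μ δ v g hk hT hμ hδ hv hg hβ2 Ω _ P _ I J hrun
  have hL := DecoupledMAB.one_le_log hk hδ
  have hT1 : (1 : ℝ) ≤ T := by exact_mod_cast hT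
  have hk2 : (2 : ℝ) ≤ k := by exact_mod_cast hk
  set L := Real.log (3 * k / δ) with hLdef
  -- The term `k²/T^{3/2}` is only slack: the bound is proved without it.
  have hdrop : 40 * L * (√((v ^ 2 / μ + μ + v) * T) + (k : ℝ) ^ 2 / μ) ≤
      40 * L * (√((v ^ 2 / μ + μ + v) * T) + (k : ℝ) ^ 2 / μ +
        (k : ℝ) ^ 2 / (T : ℝ) ^ (3 / 2 : ℝ)) := by
    refine mul_le_mul_of_nonneg_left ?_ (by linarith)
    have : 0 ≤ (k : ℝ) ^ 2 / (T : ℝ) ^ (3 / 2 : ℝ) := by positivity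
    linarith
  set good : Set Ω := {ω | DecoupledMAB.regret T g (fun t => I t ω) ≤
    40 * L * (√((v ^ 2 / μ + μ + v) * T) + (k : ℝ) ^ 2 / μ +
      (k : ℝ) ^ 2 / (T : ℝ) ^ (3 / 2 : ℝ))} with hgood
  rcases lt_or_ge 1 (DecoupledMAB.gamma k T μ δ) with hγ1 | hγ1
  · have huniv : good = Set.univ := Set.eq_univ_of_forall fun ω =>
      (DecoupledMAB.regret_le_of_one_lt_gamma hk hT hμ.1 hδ hg hβ2 hγ1 _).trans hdrop
    have : 0 ≤ DecoupledMAB.excessProb P k T μ δ g J v := measureReal_nonneg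
    rw [huniv, probReal_univ]
    linarith [hδ.1]
  have hβ := DecoupledMAB.beta_pos hk hT hμ.1 hδ
  have hγ := DecoupledMAB.gamma_pos hk hT hμ.1 hδ
  set b := DecoupledMAB.beta k T μ δ with hb
  have hb1 : b ≤ 1 := by nlinarith
  set D := √(v * T) + √k with hD
  have hD0 : 0 < D :=
    add_pos_of_nonneg_of_pos (Real.sqrt_nonneg _) (Real.sqrt_pos.2 (by linarith))
  set estEvent : Fin k → Set Ω := fun i => {ω | L < ∑ t ∈ Finset.range T,
    b * (g t i - DecoupledMAB.rewardEstimate b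
      (DecoupledMAB.qVec k T μ δ g (fun s => J s ω) t) (g t) (J t ω) i)} with hestEvent
  set devEvent : Set Ω := {ω | L < ∑ t ∈ Finset.range T, ((1 / D) *
    (DecoupledMAB.pVec k T μ δ g (fun s => J s ω) t (J t ω) /
      DecoupledMAB.qVec k T μ δ g (fun s => J s ω) t (J t ω) * g t (J t ω) - g t (I t ω)) -
    2 * (1 / D) ^ 2 *
      DecoupledMAB.halfNorm (DecoupledMAB.pVec k T μ δ g (fun s => J s ω) t))} with hdevEvent
  set normEvent : Set Ω := {ω | v < 1 / (T : ℝ) * ∑ t ∈ Finset.range T,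
    DecoupledMAB.halfNorm (DecoupledMAB.pVec k T μ δ g (fun s => J s ω) t)} with hnormEvent
  have hest : ∀ i, P.real (estEvent i) ≤ δ / (3 * k) := fun i =>
    hrun.measure_lt_sum_le hk hδ
      (fun t p a => b * (g t i -
        DecoupledMAB.rewardEstimate b (DecoupledMAB.queryDist p) (g t) a.2 i))
      fun t ht y => DecoupledMAB.sum_exp_sub_rewardEstimate_le
        (DecoupledMAB.pVec_pos hk hγ hγ1 y t) (DecoupledMAB.sum_pVec hk y t) hβ.le hb1
        (hg t ht) i
  have hdev : P.real devEvent ≤ δ / (3 * k) :=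
    hrun.measure_lt_sum_le hk hδ
      (fun t p a => (1 / D) * (p a.2 / DecoupledMAB.queryDist p a.2 * g t a.2 - g t a.1) -
        2 * (1 / D) ^ 2 * DecoupledMAB.halfNorm p)
      fun t ht y => DecoupledMAB.sum_exp_weighted_sub_le
        (DecoupledMAB.pVec_pos hk hγ hγ1 y t) (DecoupledMAB.sum_pVec hk y t)
        (by positivity)
        (by rw [one_div_mul_eq_div, div_le_one hD0]; linarith [Real.sqrt_nonneg (v * T)])
        (hg t ht)
  -- Covering the whole space and using subadditivity bounds `P.real good` from below without
  -- measurability of any of these events.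
  have hcover : (Set.univ : Set Ω) ⊆
      good ∪ (normEvent ∪ (devEvent ∪ ⋃ i ∈ Finset.univ, estEvent i)) := by
    intro ω _
    by_contra hω
    simp only [Set.mem_union, Set.mem_iUnion, Finset.mem_univ, exists_const, not_or,
      not_exists] at hω
    obtain ⟨h1, h2, h3, h4⟩ := hω
    exact h1 ((DecoupledMAB.regret_le_of_estimates hk hT hμ hδ hv hg hβ2 hγ1
      (fun t => I t ω) (fun t => J t ω) (fun i => not_lt.1 (h4 i)) (not_lt.1 h3)
      (not_lt.1 h2)).trans hdrop)
  have hunion : P.real (⋃ i ∈ Finset.univ, estEvent i) ≤ k * (δ / (3 * k)) := by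
    refine (measureReal_biUnion_finset_le _ _).trans ?_
    refine (Finset.sum_le_sum fun i _ => hest i).trans ?_
    simp
  have htotal : 1 ≤ P.real good + (P.real normEvent + (P.real devEvent +
      P.real (⋃ i ∈ Finset.univ, estEvent i))) := by
    rw [← probReal_univ (μ := P)]
    refine (measureReal_mono hcover).trans ((measureReal_union_le _ _).trans ?_)
    gcongr
    refine (measureReal_union_le _ _).trans ?_
    gcongr
    exact measureReal_union_le _ _
  -- The `k + 1` deviation events cost `(k + 1)δ/(3k)` in total, which is at most `2δ/3`.
  have hδ3 : δ / (3 * k) + k * (δ / (3 * k)) ≤ δ := by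
    have h1 : k * (δ / (3 * k)) = δ / 3 := by field_simp
    have h2 : δ / (3 * k) ≤ δ / 3 :=
      div_le_div_of_nonneg_left hδ.1.le (by norm_num) (by linarith)
    linarith [hδ.1]
  have hex : DecoupledMAB.excessProb P k T μ δ g J v = P.real normEvent := rfl
  rw [hex]
  linarith
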